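/- Let $\mathbb F$ be a field. For $n \ge 0$ let $A(n)$ be the abelian Lie algebra of dimension $n$ over $\mathbb F$, and let $H(1)$ be the Heisenberg Lie algebra with basis $x_1, x_2, x$ and only nonzero bracket of basis elements (up to antisymmetry) $[x_1,x_2]=x$. Consider the four-dimensional nilpotent Lie algebras $$L_{4,1}=A(4),\qquad L_{4,2}=H(1)\oplus A(1),\qquad L_{4,3}=\langle x_1,x_2,x_3,x_4 \mid [x_1,x_2]=x_3,\ [x_1,x_3]=x_4\rangle,$$ where $x_1,\dots,x_4$ is a basis of $L_{4,3}$ and the brackets of basis elements that are not listed are zero (up to antisymmetry). For a Lie algebra $L$ over $\mathbb F$, the nonabelian tensor square $L\otimes L$ is the Lie algebra generated by the symbols $l\otimes k$ ($l,k\in L$) subject to the relations $$c(l\otimes k)=cl\otimes k=l\otimes ck,\quad (l+l')\otimes k=l\otimes k+l'\otimes k,\quad l\otimes(k+k')=l\otimes k+l\otimes k',$$ $$[l,l']\otimes k=l\otimes[l',k]-l'\otimes[l,k],\quad l\otimes[k,k']=[k',l]\otimes k-[k,l]\otimes k',$$ $$[l\otimes k,l'\otimes k']=-[k,l]\otimes[l',k']$$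 for all $c\in\mathbb F$ and $l,l',k,k'\in L$. The diagonal ideal $L\,\square\,L$ is the ideal of $L\otimes L$ generated by the elements $l\otimes l$ ($l\in L$), and $L\wedge L=(L\otimes L)/(L\,\square\,L)$ is the nonabelian exterior square. The Schur multiplier $M(L)=H_2(L)$ is the second homology of $L$ with trivial coefficients in $\mathbb F$, i.e. the kernel of $\bigwedge^2L\to L$, $x\wedge y\mapsto[x,y]$, modulo the image of $\bigwedge^3L\to\bigwedge^2L$, $x\wedge y\wedge z\mapsto[x,y]\wedge z-[x,z]\wedge y+[y,z]\wedge x$, where the exterior powers are those of the vector space $L$; it is regarded as an abelian Lie algebra. Then, as Lie algebras over $\mathbb F$: (i) $M(L_{4,1})\simeq A(6)$, $M(L_{4,2})\simeq A(4)$ and $M(L_{4,3})\simeq A(2)$; (ii) $L_{4,1}\wedge L_{4,1}\simeq A(6)$, $L_{4,2}\wedge L_{4,2}\simeq A(5)$ and $L_{4,3}\wedge L_{4,3}\simeq A(4)$; (iii) $L_{4,1}\otimes L_{4,1}\simeq A(16)$, $L_{4,2}\otimes L_{4,2}\simeq A(11)$ and $L_{4,3}\otimes L_{4,3}\simeq A(7)$;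 (iv) $L_{4,1}\,\square\,L_{4,1}\simeq A(10)$, $L_{4,2}\,\square\,L_{4,2}\simeq A(6)$ and $L_{4,3}\,\square\,L_{4,3}\simeq A(3)$. -/

import Mathlib

noncomputable section

namespace NilpotentLie

universe u v

/-! ### The nilpotent Lie algebras of dimension four -/

/-- The abelian Lie algebra `A(n)` of dimension `n` over `F`. -/
def A (F : Type u) (n : ℕ) : Type u := Fin n → F

instance (F : Type u) [Field F] (n : ℕ) : AddCommGroup (A F n) :=
  inferInstanceAs (AddCommGroup (Fin n → F))

instance (F : Type u) [Field F] (n : ℕ) : Module F (A F n) :=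
  inferInstanceAs (Module F (Fin n → F))

instance (F : Type u) [Field F] (n : ℕ) : LieRing (A F n) where
  bracket _ _ := 0
  add_lie _ _ _ := (add_zero _).symm
  lie_add _ _ _ := (add_zero _).symm
  lie_self _ := rfl
  leibniz_lie _ _ _ := (add_zero _).symm

instance (F : Type u) [Field F] (n : ℕ) : LieAlgebra F (A F n) where
  lie_smul _ _ _ := (smul_zero _).symm

/-- The three-dimensional Heisenberg Lie algebra `H(1)`: with respect to the standard basis
`x₁, x₂, x`, the only nonzero brackets are `[x₁, x₂] = x = -[x₂, x₁]`. -/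
def H1 (F : Type u) : Type u := Fin 3 → F

instance (F : Type u) [Field F] : AddCommGroup (H1 F) :=
  inferInstanceAs (AddCommGroup (Fin 3 → F))

instance (F : Type u) [Field F] : Module F (H1 F) :=
  inferInstanceAs (Module F (Fin 3 → F))

/-- The bracket of `H(1)` in coordinates. -/
def H1.bracket {F : Type u} [Field F] (a b : Fin 3 → F) : Fin 3 → F :=
  ![0, 0, a 0 * b 1 - a 1 * b 0]

instance (F : Type u) [Field F] : LieRing (H1 F) where
  bracket := H1.bracket
  add_lie := show ∀ a b c : Fin 3 → F, H1.bracket (a + b) c = H1.bracket a c + H1.bracket b c by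
    intro a b c; ext i; fin_cases i <;> simp [H1.bracket] ; ring
  lie_add := show ∀ a b c : Fin 3 → F, H1.bracket a (b + c) = H1.bracket a b + H1.bracket a c by
    intro a b c; ext i; fin_cases i <;> simp [H1.bracket] ; ring
  lie_self := show ∀ a : Fin 3 → F, H1.bracket a a = 0 by
    intro a; ext i; fin_cases i <;> simp [H1.bracket] ; ring
  leibniz_lie := show ∀ a b c : Fin 3 → F, H1.bracket a (H1.bracket b c) =
      H1.bracket (H1.bracket a b) c + H1.bracket b (H1.bracket a c) by
    intro a b c; ext i; fin_cases i <;> simp [H1.bracket]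

instance (F : Type u) [Field F] : LieAlgebra F (H1 F) where
  lie_smul := show ∀ (t : F) (a b : Fin 3 → F), H1.bracket a (t • b) = t • H1.bracket a b by
    intro t a b; ext i; fin_cases i <;> simp [H1.bracket] ; ring

/-- `L_{4,1} = A(4)`. -/
abbrev L41 (F : Type u) : Type u := A F 4

/-- `L_{4,2} = H(1) ⊕ A(1)`, the direct sum having the componentwise bracket. -/
abbrev L42 (F : Type u) : Type u := H1 F × A F 1

/-- `L_{4,3}`: with respect to the standard basis `x₁, x₂, x₃, x₄`, the only nonzero brackets are
`[x₁, x₂] = x₃ = -[x₂, x₁]` and `[x₁, x₃] = x₄ = -[x₃, x₁]`. -/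
def L43 (F : Type u) : Type u := Fin 4 → F

instance (F : Type u) [Field F] : AddCommGroup (L43 F) :=
  inferInstanceAs (AddCommGroup (Fin 4 → F))

instance (F : Type u) [Field F] : Module F (L43 F) :=
  inferInstanceAs (Module F (Fin 4 → F))

/-- The bracket of `L_{4,3}` in coordinates. -/
def L43.bracket {F : Type u} [Field F] (a b : Fin 4 → F) : Fin 4 → F :=
  ![0, 0, a 0 * b 1 - a 1 * b 0, a 0 * b 2 - a 2 * b 0]

instance (F : Type u) [Field F] : LieRing (L43 F) where
  bracket := L43.bracket
  add_lie := show ∀ a b c : Fin 4 → F, L43.bracket (a + b) c = L43.bracket a c + L43.bracket b c by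
    intro a b c; ext i; fin_cases i <;> simp [L43.bracket] <;> ring
  lie_add := show ∀ a b c : Fin 4 → F, L43.bracket a (b + c) = L43.bracket a b + L43.bracket a c by
    intro a b c; ext i; fin_cases i <;> simp [L43.bracket] <;> ring
  lie_self := show ∀ a : Fin 4 → F, L43.bracket a a = 0 by
    intro a; ext i; fin_cases i <;> simp [L43.bracket] <;> ring
  leibniz_lie := show ∀ a b c : Fin 4 → F, L43.bracket a (L43.bracket b c) =
      L43.bracket (L43.bracket a b) c + L43.bracket b (L43.bracket a c) by
    intro a b c; ext i; fin_cases i <;> simp [L43.bracket]; ring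

instance (F : Type u) [Field F] : LieAlgebra F (L43 F) where
  lie_smul := show ∀ (t : F) (a b : Fin 4 → F), L43.bracket a (t • b) = t • L43.bracket a b by
    intro t a b; ext i; fin_cases i <;> simp [L43.bracket] <;> ring

/-! ### The nonabelian tensor square, the diagonal ideal and the nonabelian exterior square -/

section Squares

variable (F : Type u) (L : Type v) [Field F] [LieRing L] [LieAlgebra F L]

/-- The generator of the free Lie algebra on `L × L` which becomes the symbol `l ⊗ k`. -/
abbrev sym {L : Type v} (l k : L) : FreeLieAlgebra F (L × L) := FreeLieAlgebra.of F (l, k)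

/-- The relators of the nonabelian tensor square, `L` acting on itself by `ˡk = [l, k]`. -/
inductive TensorRelator : FreeLieAlgebra F (L × L) → Prop
  /-- `c (l ⊗ k) = c l ⊗ k` -/
  | smul_left (c : F) (l k : L) : TensorRelator (c • sym F l k - sym F (c • l) k)
  /-- `c (l ⊗ k) = l ⊗ c k` -/
  | smul_right (c : F) (l k : L) : TensorRelator (c • sym F l k - sym F l (c • k))
  /-- `(l + l') ⊗ k = l ⊗ k + l' ⊗ k` -/
  | add_left (l l' k : L) : TensorRelator (sym F (l + l') k - (sym F l k + sym F l' k))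
  /-- `l ⊗ (k + k') = l ⊗ k + l ⊗ k'` -/
  | add_right (l k k' : L) : TensorRelator (sym F l (k + k') - (sym F l k + sym F l k'))
  /-- `[l, l'] ⊗ k = l ⊗ [l', k] - l' ⊗ [l, k]` -/
  | lie_left (l l' k : L) : TensorRelator (sym F ⁅l, l'⁆ k - (sym F l ⁅l', k⁆ - sym F l' ⁅l, k⁆))
  /-- `l ⊗ [k, k'] = [k', l] ⊗ k - [k, l] ⊗ k'` -/
  | lie_right (l k k' : L) :
      TensorRelator (sym F l ⁅k, k'⁆ - (sym F ⁅k', l⁆ k - sym F ⁅k, l⁆ k'))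
  /-- `[l ⊗ k, l' ⊗ k'] = -([k, l] ⊗ [l', k'])` -/
  | lie (l k l' k' : L) :
      TensorRelator (⁅sym F l k, sym F l' k'⁆ - -(sym F ⁅k, l⁆ ⁅l', k'⁆))

/-- The ideal of the free Lie algebra on the symbols `l ⊗ k` generated by the relators. -/
def tensorIdeal : LieIdeal F (FreeLieAlgebra F (L × L)) :=
  LieSubmodule.lieSpan F (FreeLieAlgebra F (L × L)) {r | TensorRelator F L r}

/-- The nonabelian tensor square `L ⊗ L`. -/
abbrev TensorSquare : Type (max u v) := FreeLieAlgebra F (L × L) ⧸ tensorIdeal F L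

variable {L} in
/-- The element `l ⊗ k` of the nonabelian tensor square. -/
def tmul (l k : L) : TensorSquare F L := LieSubmodule.Quotient.mk (sym F l k)

/-- The diagonal ideal `L □ L` of `L ⊗ L`, generated by the elements `l ⊗ l`. -/
def diagonalIdeal : LieIdeal F (TensorSquare F L) :=
  LieSubmodule.lieSpan F (TensorSquare F L) (Set.range fun l : L => tmul F l l)

/-- The nonabelian exterior square `L ∧ L = (L ⊗ L) / (L □ L)`. -/
abbrev ExteriorSquare : Type (max u v) := TensorSquare F L ⧸ diagonalIdeal F L

end Squares

/-! ### The Schur multiplier -/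

section Schur

variable (F : Type u) (L : Type v) [Field F] [LieRing L] [LieAlgebra F L]

/-- The space of `n`-chains of the Chevalley-Eilenberg complex of `L` with trivial coefficients,
namely the `n`-th exterior power of the vector space `L`. -/
def Chain (n : ℕ) : Type (max u v) := ⋀[F]^n L

instance (n : ℕ) : AddCommGroup (Chain F L n) :=
  inferInstanceAs (AddCommGroup (⋀[F]^n L))

instance (n : ℕ) : Module F (Chain F L n) :=
  inferInstanceAs (Module F (⋀[F]^n L))

/-- The universal alternating map `(x₁, …, xₙ) ↦ x₁ ∧ ⋯ ∧ xₙ`. -/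
def Chain.ι (n : ℕ) : L [⋀^Fin n]→ₗ[F] Chain F L n := exteriorPower.ιMulti F n

variable {F L} in
/-- The linear map on `n`-chains induced by an alternating map. -/
def Chain.lift {n : ℕ} {N : Type*} [AddCommGroup N] [Module F N] (f : L [⋀^Fin n]→ₗ[F] N) :
    Chain F L n →ₗ[F] N := exteriorPower.alternatingMapLinearEquiv f

theorem Chain.lift_ι {n : ℕ} {N : Type*} [AddCommGroup N] [Module F N] (f : L [⋀^Fin n]→ₗ[F] N)
    (x : Fin n → L) : Chain.lift f (Chain.ι F L n x) = f x :=
  exteriorPower.alternatingMapLinearEquiv_apply_ιMulti f x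

theorem Chain.span_ι (n : ℕ) : Submodule.span F (Set.range (Chain.ι F L n)) = ⊤ :=
  exteriorPower.ιMulti_span F n L

theorem Chain.hom_ext {n : ℕ} {N : Type*} [AddCommGroup N] [Module F N]
    {f g : Chain F L n →ₗ[F] N} (h : ∀ x, f (Chain.ι F L n x) = g (Chain.ι F L n x)) : f = g :=
  LinearMap.ext_on_range (Chain.span_ι F L n) h

/-- `(x, y) ↦ [x, y]` as an alternating map. -/
def alt2 : L [⋀^Fin 2]→ₗ[F] L where
  toFun x := ⁅x 0, x 1⁆
  map_update_add' := by
    intro inst m i x y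
    rw [Subsingleton.elim inst (instDecidableEqFin 2)]
    fin_cases i <;> simp
  map_update_smul' := by
    intro inst m i c x
    rw [Subsingleton.elim inst (instDecidableEqFin 2)]
    fin_cases i <;> simp
  map_eq_zero_of_eq' := by
    intro v i j h hij
    fin_cases i <;> fin_cases j <;> simp_all

variable {L} in
/-- The element `x ∧ y` of the space of `2`-chains. -/
def wedge (x y : L) : Chain F L 2 := Chain.ι F L 2 ![x, y]

theorem wedge_add_left (x x' y : L) : wedge F (x + x') y = wedge F x y + wedge F x' y :=
  (Chain.ι F L 2).toMultilinearMap.cons_add ![y] x x'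

theorem wedge_smul_left (c : F) (x y : L) : wedge F (c • x) y = c • wedge F x y :=
  (Chain.ι F L 2).toMultilinearMap.cons_smul ![y] c x

theorem wedge_swap (x y : L) : wedge F y x = - wedge F x y := by
  have h := (Chain.ι F L 2).map_swap ![x, y] (i := 0) (j := 1) (by decide)
  have e : ![x, y] ∘ Equiv.swap (0 : Fin 2) 1 = ![y, x] := by
    ext i; fin_cases i <;> simp
  rwa [e] at h

theorem wedge_add_right (x y y' : L) : wedge F x (y + y') = wedge F x y + wedge F x y' := by
  rw [wedge_swap F L (y + y') x, wedge_add_left, wedge_swap F L y x, wedge_swap F L y' x, neg_add]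

theorem wedge_smul_right (c : F) (x y : L) : wedge F x (c • y) = c • wedge F x y := by
  rw [wedge_swap F L (c • y) x, wedge_smul_left, wedge_swap F L y x, smul_neg]

theorem wedge_self (x : L) : wedge F x x = 0 :=
  (Chain.ι F L 2).map_eq_zero_of_eq ![x, x] (i := 0) (j := 1) rfl (by decide)

theorem wedge_neg_left (x y : L) : wedge F (-x) y = - wedge F x y := by
  rw [← neg_one_smul F x, wedge_smul_left, neg_one_smul]

theorem wedge_zero_left (y : L) : wedge F 0 y = 0 := by
  simpa using wedge_smul_left F L 0 0 y

/-- `(x, y, z) ↦ [x, y] ∧ z - [x, z] ∧ y + [y, z] ∧ x` as an alternating map. -/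
def alt3 : L [⋀^Fin 3]→ₗ[F] Chain F L 2 where
  toFun x := wedge F ⁅x 0, x 1⁆ (x 2) - wedge F ⁅x 0, x 2⁆ (x 1) + wedge F ⁅x 1, x 2⁆ (x 0)
  map_update_add' := by
    have h01 : (0 : Fin 3) ≠ 1 := by decide
    have h02 : (0 : Fin 3) ≠ 2 := by decide
    have h12 : (1 : Fin 3) ≠ 2 := by decide
    have hi : ∀ i : Fin 3, i = 0 ∨ i = 1 ∨ i = 2 := by decide
    intro inst m i x y
    obtain rfl | rfl | rfl := hi i
    all_goals
      simp only [Function.update_self, Function.update_of_ne h01, Function.update_of_ne h02,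
        Function.update_of_ne h12, Function.update_of_ne h01.symm, Function.update_of_ne h02.symm,
        Function.update_of_ne h12.symm, add_lie, lie_add, wedge_add_left, wedge_add_right]
      abel
  map_update_smul' := by
    have h01 : (0 : Fin 3) ≠ 1 := by decide
    have h02 : (0 : Fin 3) ≠ 2 := by decide
    have h12 : (1 : Fin 3) ≠ 2 := by decide
    have hi : ∀ i : Fin 3, i = 0 ∨ i = 1 ∨ i = 2 := by decide
    intro inst m i c x
    obtain rfl | rfl | rfl := hi i
    all_goals
      simp only [Function.update_self, Function.update_of_ne h01, Function.update_of_ne h02,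
        Function.update_of_ne h12, Function.update_of_ne h01.symm, Function.update_of_ne h02.symm,
        Function.update_of_ne h12.symm, smul_lie, lie_smul, wedge_smul_left, wedge_smul_right,
        smul_sub, smul_add]
  map_eq_zero_of_eq' := by
    intro v i j h hij
    have key : ∀ a b c : L, wedge F ⁅a, b⁆ c + wedge F ⁅b, a⁆ c = 0 := by
      intro a b c
      rw [← lie_skew a b, wedge_neg_left, neg_add_cancel]
    have key' : ∀ a b c : L, -wedge F ⁅a, b⁆ c - wedge F ⁅b, a⁆ c = 0 := by
      intro a b c
      rw [← neg_add', key, neg_zero]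
    fin_cases i <;> fin_cases j <;> simp_all [wedge_zero_left]

/-- The Chevalley-Eilenberg differential `⋀² L → L`, `x ∧ y ↦ [x, y]`. -/
def d2 : Chain F L 2 →ₗ[F] L := Chain.lift (alt2 F L)

/-- The Chevalley-Eilenberg differential `⋀³ L → ⋀² L`,
`x ∧ y ∧ z ↦ [x, y] ∧ z - [x, z] ∧ y + [y, z] ∧ x`. -/
def d3 : Chain F L 3 →ₗ[F] Chain F L 2 := Chain.lift (alt3 F L)

theorem d2_wedge (x y : L) : d2 F L (wedge F x y) = ⁅x, y⁆ :=
  Chain.lift_ι F L (alt2 F L) ![x, y]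

theorem d3_ι (x : Fin 3 → L) : d3 F L (Chain.ι F L 3 x) =
    wedge F ⁅x 0, x 1⁆ (x 2) - wedge F ⁅x 0, x 2⁆ (x 1) + wedge F ⁅x 1, x 2⁆ (x 0) :=
  Chain.lift_ι F L (alt3 F L) x

theorem d2_comp_d3 : d2 F L ∘ₗ d3 F L = 0 := by
  refine Chain.hom_ext F L fun v => ?_
  rw [LinearMap.comp_apply, d3_ι]
  simp only [map_add, map_sub, d2_wedge, LinearMap.zero_apply]
  rw [lie_lie (v 0) (v 1) (v 2), ← lie_skew ⁅v 0, v 2⁆ (v 1), ← lie_skew ⁅v 1, v 2⁆ (v 0)]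
  abel

/-- The boundaries `im d₃`, as a subspace of the space of cycles `ker d₂`. -/
def boundaries : Submodule F (LinearMap.ker (d2 F L)) :=
  (LinearMap.range (d3 F L)).submoduleOf (LinearMap.ker (d2 F L))

/-- The Schur multiplier `M(L) = H₂(L) = ker d₂ / im d₃`, the second homology of `L` with trivial
coefficients in the ground field. -/
def SchurMultiplier : Type (max u v) := LinearMap.ker (d2 F L) ⧸ boundaries F L

instance : AddCommGroup (SchurMultiplier F L) :=
  inferInstanceAs (AddCommGroup (LinearMap.ker (d2 F L) ⧸ boundaries F L))

instance : Module F (SchurMultiplier F L) :=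
  inferInstanceAs (Module F (LinearMap.ker (d2 F L) ⧸ boundaries F L))

/-- As usual, the homology space `M(L)` is regarded as an abelian Lie algebra. -/
instance : LieRing (SchurMultiplier F L) where
  bracket _ _ := 0
  add_lie _ _ _ := (add_zero _).symm
  lie_add _ _ _ := (add_zero _).symm
  lie_self _ := rfl
  leibniz_lie _ _ _ := (add_zero _).symm

instance : LieAlgebra F (SchurMultiplier F L) where
  lie_smul _ _ _ := (smul_zero _).symm

end Schur

end NilpotentLie

end

/-!
The reason for the stated dimensions is that in the nonabelian tensor square `L ⊗ L` of any of these
Lie algebras all brackets vanish, so that everything reduces to linear algebra over `F`.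

Comparing the two relations that expand `⁅l, l'⁆ ⊗ k` and `l ⊗ ⁅k, k'⁆` shows that a symbol with one
entry in `[L, L]` is antisymmetric (`tmul_lie_comm`), and `⁅a ⊗ b, a ⊗ b⁆ = 0` shows that
`⁅a, b⁆ ⊗ ⁅a, b⁆ = 0` (`tmul_lie_self`); both hold in every characteristic. Hence `L ⊗ L` is spanned
by two kinds of symbols: the products `xᵢ ⊗ xⱼ` of representatives of a basis of `L / [L, L]`, and
some symbols with an entry in `[L, L]`, subject to the Jacobi-type relations
`⁅a, b⁆ ⊗ c + ⁅b, c⁆ ⊗ a + ⁅c, a⁆ ⊗ b = 0`. That the remaining symbols are linearly independent is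
seen from coordinate functions: products of coordinates for the first kind, alternating `2 × 2`
minors for the second kind, which satisfy the same relations. A basis with these properties is an
`IsTensorFrame`, and `IsTensorFrame.exists_equiv` turns it into coordinates on `L ⊗ L`. With
`m = dim L / [L, L]` and `r` symbols of the second kind, `L ⊗ L` has dimension `m² + r`, the diagonal
ideal corresponds to the symmetric `m × m` matrices (`IsTensorFrame.finrank_diagonalIdeal`), and
`L ∧ L` has the complementary dimension. The pairs `(m, r)` are `(4, 0)`, `(3, 2)` and `(2, 3)`.

For the Schur multiplier, rank-nullity gives `dim M(L) = 6 - rank d₂ - rank d₃`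
(`finrank_schurMultiplier`), and both ranks are `0`, `1`, `2` in the three cases.
-/

noncomputable section

namespace NilpotentLie

open Module

/-! ### Abelian Lie algebras -/

section General

variable {F : Type*} [Field F]

theorem nonempty_linearEquiv_A {V : Type*} [AddCommGroup V] [Module F V] [Module.Finite F V]
    {n : ℕ} (hn : finrank F V = n) : Nonempty (V ≃ₗ[F] A F n) :=
  ⟨(finBasisOfFinrankEq F V hn).equivFun⟩

theorem nonempty_lieEquiv_A {X : Type*} [LieRing X] [LieAlgebra F X] [Module.Finite F X]
    (hX : ∀ x y : X, ⁅x, y⁆ = 0) {n : ℕ} (hn : finrank F X = n) : Nonempty (X ≃ₗ⁅F⁆ A F n) := by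
  obtain ⟨e⟩ := nonempty_linearEquiv_A (F := F) hn
  exact ⟨{ e with
    map_lie' := by
      intro x y
      change e ⁅x, y⁆ = 0
      rw [hX, map_zero] }⟩

end General

/-! ### Calculus in the nonabelian tensor square -/

section Tensor

variable {F : Type*} {L : Type*} [Field F] [LieRing L] [LieAlgebra F L]

theorem mk_eq_of_tensorRelator {x y : FreeLieAlgebra F (L × L)} (h : TensorRelator F L (x - y)) :
    (LieSubmodule.Quotient.mk x : TensorSquare F L) = LieSubmodule.Quotient.mk y :=
  (Submodule.Quotient.eq _).2 (LieSubmodule.subset_lieSpan h)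

theorem tmul_add_left (l l' k : L) : tmul F (l + l') k = tmul F l k + tmul F l' k :=
  mk_eq_of_tensorRelator (.add_left l l' k)

theorem tmul_add_right (l k k' : L) : tmul F l (k + k') = tmul F l k + tmul F l k' :=
  mk_eq_of_tensorRelator (.add_right l k k')

theorem tmul_smul_left (c : F) (l k : L) : tmul F (c • l) k = c • tmul F l k :=
  (mk_eq_of_tensorRelator (.smul_left c l k)).symm

theorem tmul_smul_right (c : F) (l k : L) : tmul F l (c • k) = c • tmul F l k :=
  (mk_eq_of_tensorRelator (.smul_right c l k)).symm

theorem tmul_lie_left (l l' k : L) :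
    tmul F ⁅l, l'⁆ k = tmul F l ⁅l', k⁆ - tmul F l' ⁅l, k⁆ :=
  mk_eq_of_tensorRelator (.lie_left l l' k)

theorem tmul_lie_right (l k k' : L) :
    tmul F l ⁅k, k'⁆ = tmul F ⁅k', l⁆ k - tmul F ⁅k, l⁆ k' :=
  mk_eq_of_tensorRelator (.lie_right l k k')

theorem lie_tmul_tmul (l k l' k' : L) :
    ⁅tmul F l k, tmul F l' k'⁆ = -tmul F ⁅k, l⁆ ⁅l', k'⁆ :=
  mk_eq_of_tensorRelator (.lie l k l' k')

variable (F L) in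
/-- The symbol `l ⊗ k` as a bilinear map. -/
def tmulHom : L →ₗ[F] L →ₗ[F] TensorSquare F L :=
  LinearMap.mk₂ F (tmul F) tmul_add_left tmul_smul_left tmul_add_right tmul_smul_right

@[simp]
theorem tmulHom_apply (l k : L) : tmulHom F L l k = tmul F l k := rfl

theorem tmul_neg_left (l k : L) : tmul F (-l) k = -tmul F l k := by
  rw [← tmulHom_apply, map_neg]; rfl

theorem tmul_zero_right (l : L) : tmul F l 0 = 0 := by
  rw [← tmulHom_apply, map_zero]

/-- Symbols with one entry in `[L, L]` are antisymmetric: compare `lie_left` for `⁅a, k⁆ ⊗ b` with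
`lie_right` for `a ⊗ ⁅k, b⁆`. This needs no division by `2`. -/
theorem tmul_lie_comm (a b k : L) : tmul F k ⁅a, b⁆ = -tmul F ⁅a, b⁆ k := by
  have h₁ := tmul_lie_left (F := F) a k b
  have h₂ := tmul_lie_right (F := F) a k b
  rw [← lie_skew b a, ← lie_skew k a, tmul_neg_left, tmul_neg_left] at h₂
  rw [h₂] at h₁
  rw [← sub_eq_zero] at h₁ ⊢
  rw [← h₁]
  abel

/-- The vanishing of `⁅a ⊗ b, a ⊗ b⁆`, read through the relation for brackets. Antisymmetry alone
would not give this in characteristic `2`. -/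
theorem tmul_lie_self (a b : L) : tmul F ⁅a, b⁆ ⁅a, b⁆ = 0 := by
  have h := lie_tmul_tmul (F := F) a b a b
  rw [lie_self, ← lie_skew b a, tmul_neg_left, neg_neg] at h
  exact h.symm

/-- The universal property of `L ⊗ L` for abelian targets: there the relation for brackets only
asks that `f` vanish on `[L, L] × [L, L]`. -/
theorem exists_tensorSquare_hom {V : Type*} [AddCommGroup V] [Module F V] [Module.Finite F V]
    (f : L →ₗ[F] L →ₗ[F] V)
    (hleft : ∀ l l' k : L, f ⁅l, l'⁆ k = f l ⁅l', k⁆ - f l' ⁅l, k⁆)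
    (hright : ∀ l k k' : L, f l ⁅k, k'⁆ = f ⁅k', l⁆ k - f ⁅k, l⁆ k')
    (hlie : ∀ a b c d : L, f ⁅a, b⁆ ⁅c, d⁆ = 0) :
    ∃ g : TensorSquare F L →ₗ[F] V, ∀ l k, g (tmul F l k) = f l k := by
  obtain ⟨e⟩ := nonempty_linearEquiv_A (F := F) (V := V) rfl
  let G : FreeLieAlgebra F (L × L) →ₗ⁅F⁆ A F (finrank F V) :=
    FreeLieAlgebra.lift F fun p => e (f p.1 p.2)
  have hG : ∀ l k, G (sym F l k) = e (f l k) := fun l k =>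
    FreeLieAlgebra.lift_of_apply _ _
  have hker : tensorIdeal F L ≤ G.ker := by
    refine LieSubmodule.lieSpan_le.2 ?_
    intro r hr
    change r ∈ G.ker
    rw [LieHom.mem_ker]
    induction hr with
    | smul_left | smul_right | add_left | add_right => simp [hG]
    | lie_left l l' k => simp [hG, hleft l l' k]
    | lie_right l k k' => simp [hG, hright l k k']
    | lie l k l' k' =>
      rw [map_sub, map_neg, LieHom.map_lie, hG, hG, hG, hlie, map_zero, neg_zero, sub_zero]
      rfl
  refine ⟨e.symm.toLinearMap ∘ₗ Submodule.liftQ (tensorIdeal F L).toSubmodule (G : _ →ₗ[F] _)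
    fun x hx => ?_, fun l k => ?_⟩
  · exact LieHom.mem_ker.1 (hker hx)
  · change e.symm (G (sym F l k)) = f l k
    rw [hG, e.symm_apply_apply]

/-- A subspace of `L ⊗ L` that contains all symbols is everything as soon as its elements commute,
since it is then a Lie subalgebra that contains the generators. -/
theorem surjective_of_tmul_mem_range {V : Type*} [AddCommGroup V] [Module F V]
    (f : V →ₗ[F] TensorSquare F L) (hf : ∀ l k, tmul F l k ∈ LinearMap.range f)
    (hlie : ∀ x ∈ LinearMap.range f, ∀ y ∈ LinearMap.range f, ⁅x, y⁆ = 0) :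
    Function.Surjective f := by
  let K : LieSubalgebra F (TensorSquare F L) :=
    { LinearMap.range f with
      lie_mem' := fun {x y} hx hy => by
        change ⁅x, y⁆ ∈ LinearMap.range f
        rw [hlie x hx y hy]; exact zero_mem _ }
  let G : FreeLieAlgebra F (L × L) →ₗ⁅F⁆ K :=
    FreeLieAlgebra.lift F fun p => ⟨tmul F p.1 p.2, hf p.1 p.2⟩
  let q : FreeLieAlgebra F (L × L) →ₗ⁅F⁆ TensorSquare F L :=
    { (tensorIdeal F L).toSubmodule.mkQ with map_lie' := fun {_ _} => rfl }
  have hq : K.incl.comp G = q := by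
    refine FreeLieAlgebra.hom_ext fun p => ?_
    rw [LieHom.comp_apply, FreeLieAlgebra.lift_of_apply]
    rfl
  intro x
  obtain ⟨y, rfl⟩ := Submodule.Quotient.mk_surjective _ x
  have := (G y).2
  have h2 : ((G y : K) : TensorSquare F L) = q y := by rw [← hq]; rfl
  rw [h2] at this
  exact this

end Tensor

/-! ### Tensor squares with an explicit basis -/

section Coordinates

variable {F : Type*} {L : Type*} [Field F] [LieRing L] [LieAlgebra F L]

/-- The alternating bilinear form `(l, k) ↦ f l * g k - g l * f k` on `L`. -/
def minor (f g : Dual F L) : L →ₗ[F] L →ₗ[F] F :=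
  LinearMap.mk₂ F (fun l k => f l * g k - g l * f k)
    (fun l l' k => by simp only [map_add]; ring)
    (fun c l k => by simp only [map_smul, smul_eq_mul]; ring)
    (fun l k k' => by simp only [map_add]; ring)
    (fun c l k => by simp only [map_smul, smul_eq_mul]; ring)

theorem minor_apply (f g : Dual F L) (l k : L) : minor f g l k = f l * g k - g l * f k := rfl

variable {J ι κ : Type*}

/-- The bilinear map on `L` that becomes the coordinate map of `L ⊗ L` for a frame `(b, s, p, q)`
(see `IsTensorFrame`). Its coordinate at `(i, j)` is the product of the coordinates `s i` and `s j`
of the two arguments, and its coordinate at `r` is their `(p r, q r)`-minor. -/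
def tensorCoords (b : Basis J F L) (s : ι → J) (p q : κ → J) :
    L →ₗ[F] L →ₗ[F] (ι × ι ⊕ κ → F) :=
  LinearMap.mk₂ F
    (fun l k => Sum.elim (fun x => b.coord (s x.1) l * b.coord (s x.2) k)
      (fun r => minor (b.coord (p r)) (b.coord (q r)) l k))
    (fun l l' k => by ext (x | r) <;> simp [add_mul])
    (fun c l k => by ext (x | r) <;> simp [mul_assoc])
    (fun l k k' => by ext (x | r) <;> simp [mul_add])
    (fun c l k => by ext (x | r) <;> simp [mul_left_comm])

/-- The symbols `b (s i) ⊗ b (s j)` and `b (p r) ⊗ b (q r)`, which form a basis of `L ⊗ L` for a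
frame `(b, s, p, q)`. -/
def tensorFamily (b : Basis J F L) (s : ι → J) (p q : κ → J) : ι × ι ⊕ κ → TensorSquare F L :=
  Sum.elim (fun x => tmul F (b (s x.1)) (b (s x.2))) (fun r => tmul F (b (p r)) (b (q r)))

/-- The data `(b, s, p, q)` is a *frame* if the basis vectors `b (s i)` represent a basis of
`L / [L, L]`, and the symbols `b (p r) ⊗ b (q r)` are a basis of the part of `L ⊗ L` that comes
from `[L, L]`. The conditions make `tensorCoords` and `tensorFamily` dual to each other:
`coord_lie`, `minor_lie` and `minor_lie_lie` say that `tensorCoords` respects the relations of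
`L ⊗ L`, the Jacobi-type identity `minor_lie` being the cocycle condition on the minors, and
`tmul_eq` says that the family spans all symbols. -/
structure IsTensorFrame [Fintype ι] [Fintype κ] [DecidableEq κ] (b : Basis J F L)
    (s : ι → J) (p q : κ → J) : Prop where
  injective : Function.Injective s
  ne (i : ι) (r : κ) : p r ≠ s i
  minor_basis (r r' : κ) : minor (b.coord (p r)) (b.coord (q r)) (b (p r')) (b (q r')) =
    if r' = r then 1 else 0
  minor_frame (r : κ) (i j : ι) :
    minor (b.coord (p r)) (b.coord (q r)) (b (s i)) (b (s j)) = 0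
  coord_lie (i : ι) (l k : L) : b.coord (s i) ⁅l, k⁆ = 0
  minor_lie (r : κ) (l k m : L) : minor (b.coord (p r)) (b.coord (q r)) ⁅l, k⁆ m +
    minor (b.coord (p r)) (b.coord (q r)) ⁅k, m⁆ l +
    minor (b.coord (p r)) (b.coord (q r)) ⁅m, l⁆ k = 0
  minor_lie_lie (r : κ) (l k l' k' : L) :
    minor (b.coord (p r)) (b.coord (q r)) ⁅l, k⁆ ⁅l', k'⁆ = 0
  tmul_eq (l k : L) : tmul F l k = ∑ i, ∑ j, (b.coord (s i) l * b.coord (s j) k) •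
      tmul F (b (s i)) (b (s j)) +
    ∑ r, minor (b.coord (p r)) (b.coord (q r)) l k • tmul F (b (p r)) (b (q r))

namespace IsTensorFrame

variable [Fintype ι] [Fintype κ] [DecidableEq κ] {b : Basis J F L} {s : ι → J} {p q : κ → J}

/-- For a frame, `L ⊗ L` is abelian and `tensorFamily` is a basis of it, with `tensorCoords` as
coordinates. -/
theorem exists_equiv (h : IsTensorFrame b s p q) :
    ∃ e : TensorSquare F L ≃ₗ[F] (ι × ι ⊕ κ → F),
      (∀ l k, e (tmul F l k) = tensorCoords b s p q l k) ∧
      (∀ x y : TensorSquare F L, ⁅x, y⁆ = 0) := by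
  classical
  have skew (f : Dual F L) (l k : L) : f ⁅k, l⁆ = -f ⁅l, k⁆ := by rw [← lie_skew, map_neg]
  have coords_lie_lie (l k l' k' : L) : tensorCoords b s p q ⁅l, k⁆ ⁅l', k'⁆ = 0 := by
    ext (x | r)
    · simp only [tensorCoords, LinearMap.mk₂_apply, Sum.elim_inl, h.coord_lie, zero_mul]; rfl
    · exact h.minor_lie_lie r l k l' k'
  obtain ⟨g, hg⟩ := exists_tensorSquare_hom (tensorCoords b s p q)
    (fun l l' k => by
      ext (x | r)
      · simp only [tensorCoords, LinearMap.mk₂_apply, Sum.elim_inl, h.coord_lie, Pi.sub_apply]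
        ring
      · simp only [tensorCoords, LinearMap.mk₂_apply, Sum.elim_inr, Pi.sub_apply]
        have := h.minor_lie r l l' k
        simp only [minor_apply] at this ⊢
        rw [skew _ l k, skew _ l k] at this
        linear_combination this)
    (fun l k k' => by
      ext (x | r)
      · simp only [tensorCoords, LinearMap.mk₂_apply, Sum.elim_inl, h.coord_lie, Pi.sub_apply]
        ring
      · simp only [tensorCoords, LinearMap.mk₂_apply, Sum.elim_inr, Pi.sub_apply]
        have := h.minor_lie r k k' l
        simp only [minor_apply] at this ⊢
        rw [skew _ k l, skew _ k l] at this
        linear_combination -this)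
    coords_lie_lie
  let f : (ι × ι ⊕ κ → F) →ₗ[F] TensorSquare F L :=
    Fintype.linearCombination F (tensorFamily b s p q)
  have hf : ∀ l k, f (tensorCoords b s p q l k) = tmul F l k := fun l k => by
    rw [h.tmul_eq l k]
    simp [f, Fintype.linearCombination_apply, tensorCoords, tensorFamily, Fintype.sum_prod_type]
  -- Evaluated on the family, the coordinates are the standard unit vectors.
  have hgf : g ∘ₗ f = LinearMap.id := by
    refine LinearMap.pi_ext' fun x => LinearMap.ext_ring ?_
    simp only [LinearMap.comp_apply, LinearMap.coe_single, LinearMap.id_apply, f,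
      Fintype.linearCombination_apply_single, one_smul]
    obtain ⟨i, j⟩ | r := x
    · simp only [tensorFamily, Sum.elim_inl, hg]
      ext (⟨i', j'⟩ | r)
      · simp [tensorCoords, Finsupp.single_apply, h.injective.eq_iff, Pi.single_apply, ← ite_and,
          eq_comm, and_comm]
      · simpa [tensorCoords] using h.minor_frame r i j
    · simp only [tensorFamily, Sum.elim_inr, hg]
      ext (⟨i', j'⟩ | r')
      · simp [tensorCoords, Finsupp.single_apply, h.ne]
      · simpa [tensorCoords, Pi.single_apply, eq_comm] using h.minor_basis r' r
  have hrange : ∀ x ∈ LinearMap.range f, ∀ y ∈ LinearMap.range f, ⁅x, y⁆ = 0 := by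
    have comm (l k l' k' : L) : ⁅tmul F l k, tmul F l' k'⁆ = 0 := by
      rw [lie_tmul_tmul, ← hf, coords_lie_lie, map_zero, neg_zero]
    have comm' (x y) : ⁅tensorFamily b s p q x, tensorFamily b s p q y⁆ = 0 := by
      rcases x with x | x <;> rcases y with y | y <;> exact comm _ _ _ _
    rintro _ ⟨x, rfl⟩ _ ⟨y, rfl⟩
    simp [f, Fintype.linearCombination_apply, comm', lie_sum, sum_lie]
  have hsurj : Function.Surjective f :=
    surjective_of_tmul_mem_range f (fun l k => ⟨_, hf l k⟩) hrange
  have hfg : f ∘ₗ g = LinearMap.id := by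
    ext x
    obtain ⟨y, rfl⟩ := hsurj x
    exact congrArg f (LinearMap.congr_fun hgf y)
  refine ⟨LinearEquiv.ofLinearMap g f hgf hfg, hg, fun x y => ?_⟩
  exact hrange x (hsurj x) y (hsurj y)

theorem finite_tensorSquare (h : IsTensorFrame b s p q) : Module.Finite F (TensorSquare F L) := by
  obtain ⟨e, -, -⟩ := h.exists_equiv
  exact Module.Finite.equiv e.symm

theorem finrank_tensorSquare (h : IsTensorFrame b s p q) :
    finrank F (TensorSquare F L) = Fintype.card ι * Fintype.card ι + Fintype.card κ := by
  obtain ⟨e, -, -⟩ := h.exists_equiv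
  rw [e.finrank_eq]
  simp

theorem lie_eq_zero (h : IsTensorFrame b s p q) (x y : TensorSquare F L) : ⁅x, y⁆ = 0 := by
  obtain ⟨-, -, hlie⟩ := h.exists_equiv
  exact hlie x y

/-- Since `L ⊗ L` is abelian, every subspace of it is an ideal. -/
theorem diagonalIdeal_eq_span (h : IsTensorFrame b s p q) : (diagonalIdeal F L).toSubmodule =
    Submodule.span F (Set.range fun l : L => tmul F l l) := by
  refine le_antisymm ?_ LieSubmodule.submodule_span_le_lieSpan
  let N : LieIdeal F (TensorSquare F L) :=
    { Submodule.span F (Set.range fun l : L => tmul F l l) with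
      lie_mem := fun {x m} _ => by
        change ⁅x, m⁆ ∈ Submodule.span F (Set.range fun l : L => tmul F l l)
        rw [h.lie_eq_zero]; exact zero_mem _ }
  have : diagonalIdeal F L ≤ N := LieSubmodule.lieSpan_le.2 Submodule.subset_span
  exact this

/-- In coordinates, the span of the squares `l ⊗ l` consists of the symmetric matrices indexed by
`ι`: the minors of `(l, l)` vanish, and `x ⊗ y + y ⊗ x` is a combination of squares in every
characteristic. A symmetric matrix is encoded as a function on `Sym2 ι`. -/
theorem finrank_diagonalIdeal (h : IsTensorFrame b s p q) :
    finrank F (diagonalIdeal F L) = (Fintype.card ι + 1).choose 2 := by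
  classical
  obtain ⟨e, he, -⟩ := h.exists_equiv
  let f : (Sym2 ι → F) →ₗ[F] TensorSquare F L :=
    { toFun := fun v => ∑ i, ∑ j, v s(i, j) • tmul F (b (s i)) (b (s j))
      map_add' := fun v w => by simp [add_smul, Finset.sum_add_distrib]
      map_smul' := fun c v => by simp [mul_smul, Finset.smul_sum] }
  have hf (v : Sym2 ι → F) : f v = ∑ i, ∑ j, v s(i, j) • tmul F (b (s i)) (b (s j)) := rfl
  have hinj : Function.Injective f := by
    rw [injective_iff_map_eq_zero]
    intro v hv
    ext z
    induction z with
    | _ i j =>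
      have := congrFun (congrArg e hv) (Sum.inl (i, j))
      simpa [hf, he, tensorCoords, Finsupp.single_apply, h.injective.eq_iff] using this
  have hrange : LinearMap.range f = Submodule.span F (Set.range fun l : L => tmul F l l) := by
    refine le_antisymm ?_ (Submodule.span_le.2 ?_)
    -- The image of the unit vector at `s(i, j)` is `bᵢ ⊗ bᵢ` or `bᵢ ⊗ bⱼ + bⱼ ⊗ bᵢ`.
    · have hmem (l : L) : tmul F l l ∈ Submodule.span F (Set.range fun l : L => tmul F l l) :=
        Submodule.subset_span ⟨l, rfl⟩
      rintro _ ⟨v, rfl⟩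
      rw [LinearMap.pi_apply_eq_sum_univ f v]
      refine Submodule.sum_mem _ fun z _ => Submodule.smul_mem _ _ ?_
      induction z with
      | _ i j =>
        rw [hf]
        by_cases hij : i = j
        · subst hij
          have hite (a c : ι) : (if s(i, i) = s(a, c) then (1 : F) else 0) =
              if i = a then if i = c then 1 else 0 else 0 := by
            simp only [Sym2.eq_iff]
            grind
          convert hmem (b (s i)) using 1
          simp only [hite, ite_smul, one_smul, zero_smul]
          simp
        · have hsum : tmul F (b (s i)) (b (s j)) + tmul F (b (s j)) (b (s i)) =
              tmul F (b (s i) + b (s j)) (b (s i) + b (s j)) -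
                tmul F (b (s i)) (b (s i)) - tmul F (b (s j)) (b (s j)) := by
            simp only [tmul_add_left, tmul_add_right]
            abel
          have hite (a c : ι) : (if s(i, j) = s(a, c) then (1 : F) else 0) =
              (if i = a then if j = c then 1 else 0 else 0) +
                (if j = a then if i = c then 1 else 0 else 0) := by
            simp only [Sym2.eq_iff]
            grind
          have : ∑ a, ∑ c, (if s(i, j) = s(a, c) then (1 : F) else 0) •
              tmul F (b (s a)) (b (s c)) =
              tmul F (b (s i)) (b (s j)) + tmul F (b (s j)) (b (s i)) := by
            simp only [hite, add_smul, ite_smul, one_smul, zero_smul, Finset.sum_add_distrib]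
            simp
          rw [this, hsum]
          exact sub_mem (sub_mem (hmem _) (hmem _)) (hmem _)
    · rintro _ ⟨l, rfl⟩
      refine ⟨Sym2.lift ⟨fun i j => b.coord (s i) l * b.coord (s j) l, fun i j => mul_comm _ _⟩, ?_⟩
      change _ = tmul F l l
      rw [hf, h.tmul_eq l l]
      simp [minor_apply, mul_comm]
  have h₁ : finrank F (diagonalIdeal F L) = finrank F (diagonalIdeal F L).toSubmodule := rfl
  rw [h₁, h.diagonalIdeal_eq_span, ← hrange, LinearMap.finrank_range_of_inj hinj,
    finrank_fintype_fun_eq_card, Sym2.card]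

theorem finrank_exteriorSquare (h : IsTensorFrame b s p q) :
    finrank F (ExteriorSquare F L) + (Fintype.card ι + 1).choose 2 =
      Fintype.card ι * Fintype.card ι + Fintype.card κ := by
  have := h.finite_tensorSquare
  rw [← h.finrank_tensorSquare, ← h.finrank_diagonalIdeal]
  exact Submodule.finrank_quotient_add_finrank (diagonalIdeal F L).toSubmodule

theorem nonempty_tensorSquare_equiv (h : IsTensorFrame b s p q) {n : ℕ}
    (hn : Fintype.card ι * Fintype.card ι + Fintype.card κ = n) :
    Nonempty (TensorSquare F L ≃ₗ⁅F⁆ A F n) :=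
  have := h.finite_tensorSquare
  nonempty_lieEquiv_A h.lie_eq_zero (h.finrank_tensorSquare.trans hn)

theorem nonempty_diagonalIdeal_equiv (h : IsTensorFrame b s p q) {n : ℕ}
    (hn : (Fintype.card ι + 1).choose 2 = n) :
    Nonempty (diagonalIdeal F L ≃ₗ⁅F⁆ A F n) := by
  have := h.finite_tensorSquare
  have : Module.Finite F (diagonalIdeal F L) :=
    inferInstanceAs (Module.Finite F (diagonalIdeal F L).toSubmodule)
  exact nonempty_lieEquiv_A (fun x y => Subtype.ext (h.lie_eq_zero x y))
    (h.finrank_diagonalIdeal.trans hn)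

theorem nonempty_exteriorSquare_equiv (h : IsTensorFrame b s p q) {n : ℕ}
    (hn : n + (Fintype.card ι + 1).choose 2 = Fintype.card ι * Fintype.card ι + Fintype.card κ) :
    Nonempty (ExteriorSquare F L ≃ₗ⁅F⁆ A F n) := by
  have := h.finite_tensorSquare
  have : Module.Finite F (ExteriorSquare F L) :=
    inferInstanceAs (Module.Finite F (TensorSquare F L ⧸ (diagonalIdeal F L).toSubmodule))
  refine nonempty_lieEquiv_A (fun x y => ?_)
    (Nat.add_right_cancel (h.finrank_exteriorSquare.trans hn.symm))
  obtain ⟨x, rfl⟩ := Submodule.Quotient.mk_surjective _ x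
  obtain ⟨y, rfl⟩ := Submodule.Quotient.mk_surjective _ y
  exact congrArg LieSubmodule.Quotient.mk (h.lie_eq_zero x y)

end IsTensorFrame

end Coordinates

/-! ### Frames for the three tensor squares -/

section Frames

variable {F : Type*} {L : Type*} [Field F] [LieRing L] [LieAlgebra F L]

theorem tmul_eq_sum {J : Type*} [Fintype J] (b : Basis J F L) (l k : L) :
    tmul F l k = ∑ i, ∑ j, (b.coord i l * b.coord j k) • tmul F (b i) (b j) := by
  rw [← tmulHom_apply]
  conv_lhs => rw [← b.sum_repr l, ← b.sum_repr k]
  simp only [map_sum, LinearMap.sum_apply, map_smul, LinearMap.smul_apply, tmulHom_apply,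
    Basis.coord_apply, mul_smul, Finset.smul_sum]
  rw [Finset.sum_comm]
  exact Finset.sum_congr rfl fun i _ => Finset.sum_congr rfl fun j _ => smul_comm _ _ _

/-- If `L` is abelian, then `L ⊗ L` is the tensor square of the vector space `L`, and no symbols
from `[L, L]` are needed. -/
theorem isTensorFrame_of_lie_eq_zero {J : Type*} [Fintype J] (b : Basis J F L)
    (hb : ∀ l k : L, ⁅l, k⁆ = 0) :
    IsTensorFrame b id (Fin.elim0 : Fin 0 → J) Fin.elim0 where
  injective := Function.injective_id
  ne _ r := r.elim0
  minor_basis r := r.elim0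
  minor_frame r := r.elim0
  coord_lie i l k := by rw [hb, map_zero]
  minor_lie r := r.elim0
  minor_lie_lie r := r.elim0
  tmul_eq l k := by simp [tmul_eq_sum b l k]

variable (b : Basis (Fin 4) F L)

/-- In `H(1) ⊕ A(1)` the relation `⁅b 0, b 1⁆ ⊗ b 3 = 0` leaves `b 2 ⊗ b 0` and `b 2 ⊗ b 1` as the
basis symbols from `[L, L]`. -/
theorem isTensorFrame_heisenberg
    (hb : ∀ l k : L, ⁅l, k⁆ = minor (b.coord 0) (b.coord 1) l k • b 2) :
    IsTensorFrame b ![0, 1, 3] ![2, 2] ![0, 1] where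
  injective := by decide
  ne := by decide
  minor_basis r r' := by
    fin_cases r <;> fin_cases r' <;> simp [minor_apply]
  minor_frame r i j := by
    fin_cases r <;> fin_cases i <;> fin_cases j <;> simp [minor_apply]
  coord_lie i l k := by
    fin_cases i <;> simp [hb]
  minor_lie r l k m := by
    fin_cases r <;> simp [minor_apply, hb] <;> ring
  minor_lie_lie r l k l' k' := by
    fin_cases r <;> simp [minor_apply, hb]
  tmul_eq l k := by
    have h01 : ⁅b 0, b 1⁆ = b 2 := by simp [hb, minor_apply]
    have h03 : ⁅b 0, b 3⁆ = 0 := by simp [hb, minor_apply]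
    have h13 : ⁅b 1, b 3⁆ = 0 := by simp [hb, minor_apply]
    have t22 : tmul F (b 2) (b 2) = 0 := h01 ▸ tmul_lie_self (b 0) (b 1)
    have swap (j : Fin 4) : tmul F (b j) (b 2) = -tmul F (b 2) (b j) :=
      h01 ▸ tmul_lie_comm (b 0) (b 1) (b j)
    have t23 : tmul F (b 2) (b 3) = 0 := by
      have := tmul_lie_left (F := F) (b 0) (b 1) (b 3)
      rwa [h01, h03, h13, tmul_zero_right, tmul_zero_right, sub_zero] at this
    rw [tmul_eq_sum b l k]
    simp only [Fin.sum_univ_four, Fin.sum_univ_three, Fin.sum_univ_two, swap 0, swap 1, swap 3, t22,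
      t23, minor_apply, Matrix.cons_val]
    module

/-- In `L_{4,3}` expanding `⁅b 0, b 1⁆ ⊗ b 2` and `⁅b 0, b 1⁆ ⊗ b 3` kills `b 3 ⊗ b 1` and
`b 3 ⊗ b 2`, which leaves `b 2 ⊗ b 0`, `b 2 ⊗ b 1` and `b 3 ⊗ b 0` as the basis symbols from
`[L, L]`. -/
theorem isTensorFrame_filiform
    (hb : ∀ l k : L, ⁅l, k⁆ = minor (b.coord 0) (b.coord 1) l k • b 2 +
      minor (b.coord 0) (b.coord 2) l k • b 3) :
    IsTensorFrame b ![0, 1] ![2, 2, 3] ![0, 1, 0] where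
  injective := by decide
  ne := by decide
  minor_basis r r' := by
    fin_cases r <;> fin_cases r' <;> simp [minor_apply]
  minor_frame r i j := by
    fin_cases r <;> fin_cases i <;> fin_cases j <;> simp [minor_apply]
  coord_lie i l k := by
    fin_cases i <;> simp [hb]
  minor_lie r l k m := by
    fin_cases r <;> simp [minor_apply, hb] <;> ring
  minor_lie_lie r l k l' k' := by
    fin_cases r <;> simp [minor_apply, hb]
  tmul_eq l k := by
    have h01 : ⁅b 0, b 1⁆ = b 2 := by simp [hb, minor_apply]
    have h02 : ⁅b 0, b 2⁆ = b 3 := by simp [hb, minor_apply]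
    have h12 : ⁅b 1, b 2⁆ = 0 := by simp [hb, minor_apply]
    have h03 : ⁅b 0, b 3⁆ = 0 := by simp [hb, minor_apply]
    have h13 : ⁅b 1, b 3⁆ = 0 := by simp [hb, minor_apply]
    have t22 : tmul F (b 2) (b 2) = 0 := h01 ▸ tmul_lie_self (b 0) (b 1)
    have t33 : tmul F (b 3) (b 3) = 0 := h02 ▸ tmul_lie_self (b 0) (b 2)
    have swap2 (j : Fin 4) : tmul F (b j) (b 2) = -tmul F (b 2) (b j) :=
      h01 ▸ tmul_lie_comm (b 0) (b 1) (b j)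
    have swap3 (j : Fin 4) : tmul F (b j) (b 3) = -tmul F (b 3) (b j) :=
      h02 ▸ tmul_lie_comm (b 0) (b 2) (b j)
    have t31 : tmul F (b 3) (b 1) = 0 := by
      have := tmul_lie_left (F := F) (b 0) (b 1) (b 2)
      rwa [h01, h02, h12, t22, swap3, tmul_zero_right, zero_sub, neg_neg, eq_comm] at this
    have t32 : tmul F (b 3) (b 2) = 0 := by
      have := tmul_lie_left (F := F) (b 0) (b 1) (b 3)
      rwa [h01, h03, h13, tmul_zero_right, tmul_zero_right, sub_zero, swap3, neg_eq_zero] at this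
    rw [tmul_eq_sum b l k]
    simp only [Fin.sum_univ_four, Fin.sum_univ_three, Fin.sum_univ_two, swap2 0, swap2 1, swap3 0,
      swap3 1, swap3 2, t22, t33, t31, t32, minor_apply, Matrix.cons_val]
    module

end Frames

/-! ### Dimension of the Schur multiplier -/

section Schur

variable {F : Type*} {L : Type*} [Field F] [LieRing L] [LieAlgebra F L]

/-- The alternating map underlying `minor f g`. -/
def altMinor (f g : Dual F L) : L [⋀^Fin 2]→ₗ[F] F where
  toFun x := minor f g (x 0) (x 1)
  map_update_add' := by
    intro inst m i x y
    rw [Subsingleton.elim inst (instDecidableEqFin 2)]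
    fin_cases i <;> simp
  map_update_smul' := by
    intro inst m i c x
    rw [Subsingleton.elim inst (instDecidableEqFin 2)]
    fin_cases i <;> simp
  map_eq_zero_of_eq' := by
    intro v i j h hij
    fin_cases i <;> fin_cases j <;> simp_all [minor_apply, mul_comm]

/-- The linear form on `⋀² L` induced by `minor f g`. -/
def plucker (f g : Dual F L) : Chain F L 2 →ₗ[F] F := Chain.lift (altMinor f g)

theorem plucker_wedge (f g : Dual F L) (x y : L) : plucker f g (wedge F x y) = minor f g x y :=
  Chain.lift_ι F L (altMinor f g) ![x, y]

instance [Module.Finite F L] (n : ℕ) : Module.Finite F (Chain F L n) :=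
  inferInstanceAs (Module.Finite F (⋀[F]^n L))

theorem finrank_chain [Module.Finite F L] (n : ℕ) :
    finrank F (Chain F L n) = (finrank F L).choose n :=
  exteriorPower.finrank_eq F n

/-- Rank-nullity along `⋀³ L → ⋀² L → L`. -/
theorem finrank_schurMultiplier [Module.Finite F L] :
    finrank F (SchurMultiplier F L) + finrank F (LinearMap.range (d3 F L)) +
      finrank F (LinearMap.range (d2 F L)) = (finrank F L).choose 2 := by
  have h₁ : finrank F (SchurMultiplier F L) + finrank F (boundaries F L) =
      finrank F (LinearMap.ker (d2 F L)) := Submodule.finrank_quotient_add_finrank (boundaries F L)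
  have h₂ : finrank F (boundaries F L) = finrank F (LinearMap.range (d3 F L)) :=
    (Submodule.submoduleOfEquivOfLe
      (LinearMap.range_le_ker_iff.2 (d2_comp_d3 F L))).finrank_eq
  rw [← h₂, h₁, ← finrank_chain, add_comm, LinearMap.finrank_range_add_finrank_ker]

theorem nonempty_schurMultiplier_equiv [Module.Finite F L] {n : ℕ}
    (hn : n + finrank F (LinearMap.range (d3 F L)) +
      finrank F (LinearMap.range (d2 F L)) = (finrank F L).choose 2) :
    Nonempty (SchurMultiplier F L ≃ₗ⁅F⁆ A F n) := by
  have : Module.Finite F (SchurMultiplier F L) :=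
    inferInstanceAs (Module.Finite F (LinearMap.ker (d2 F L) ⧸ boundaries F L))
  refine nonempty_lieEquiv_A (fun x y => rfl) ?_
  have := finrank_schurMultiplier (F := F) (L := L)
  omega

theorem range_d2_le {S : Submodule F L} (h : ∀ x y : L, ⁅x, y⁆ ∈ S) :
    LinearMap.range (d2 F L) ≤ S := by
  rw [LinearMap.range_eq_map, ← Chain.span_ι, Submodule.map_span, Submodule.span_le]
  rintro _ ⟨_, ⟨x, rfl⟩, rfl⟩
  exact (Chain.lift_ι F L (alt2 F L) x).symm ▸ h (x 0) (x 1)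

theorem range_d3_le {S : Submodule F (Chain F L 2)}
    (h : ∀ x y z : L, wedge F ⁅x, y⁆ z - wedge F ⁅x, z⁆ y + wedge F ⁅y, z⁆ x ∈ S) :
    LinearMap.range (d3 F L) ≤ S := by
  rw [LinearMap.range_eq_map, ← Chain.span_ι, Submodule.map_span, Submodule.span_le]
  rintro _ ⟨_, ⟨x, rfl⟩, rfl⟩
  exact (d3_ι F L x).symm ▸ h (x 0) (x 1) (x 2)

theorem wedge_mem_range_d3 (x y z : L) :
    wedge F ⁅x, y⁆ z - wedge F ⁅x, z⁆ y + wedge F ⁅y, z⁆ x ∈ LinearMap.range (d3 F L) :=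
  ⟨Chain.ι F L 3 ![x, y, z], d3_ι F L _⟩

theorem wedge_eq_sum {J : Type*} [Fintype J] (b : Basis J F L) (x y : L) :
    wedge F x y = ∑ j, b.coord j y • wedge F x (b j) := by
  let f : L →ₗ[F] Chain F L 2 :=
    { toFun := wedge F x
      map_add' := wedge_add_right F L x
      map_smul' := fun c y => wedge_smul_right F L c x y }
  change f y = ∑ j, b.coord j y • f (b j)
  conv_lhs => rw [← b.sum_repr y]
  simp only [map_sum, map_smul, Basis.coord_apply]

theorem nonempty_schurMultiplier_equiv_of_lie_eq_zero [Module.Finite F L]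
    (hb : ∀ l k : L, ⁅l, k⁆ = 0) {n : ℕ} (hn : n = (finrank F L).choose 2) :
    Nonempty (SchurMultiplier F L ≃ₗ⁅F⁆ A F n) := by
  apply nonempty_schurMultiplier_equiv
  have h₂ : LinearMap.range (d2 F L) = ⊥ :=
    le_bot_iff.1 (range_d2_le fun x y => by simp [hb])
  have h₃ : LinearMap.range (d3 F L) = ⊥ :=
    le_bot_iff.1 (range_d3_le fun x y z => by simp [hb, wedge_zero_left])
  rw [h₂, h₃]
  simp [hn]

variable (b : Basis (Fin 4) F L)

/-- For `H(1) ⊕ A(1)` both differentials have rank one, with images spanned by `b 2` and by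
`b 2 ∧ b 3`. -/
theorem nonempty_schurMultiplier_equiv_heisenberg
    (hb : ∀ l k : L, ⁅l, k⁆ = minor (b.coord 0) (b.coord 1) l k • b 2) :
    Nonempty (SchurMultiplier F L ≃ₗ⁅F⁆ A F 4) := by
  have := Module.Finite.of_basis b
  apply nonempty_schurMultiplier_equiv
  have h01 : ⁅b 0, b 1⁆ = b 2 := by simp [hb, minor_apply]
  have h03 : ⁅b 0, b 3⁆ = 0 := by simp [hb, minor_apply]
  have h13 : ⁅b 1, b 3⁆ = 0 := by simp [hb, minor_apply]
  have h₂ : LinearMap.range (d2 F L) = Submodule.span F {b 2} := by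
    refine le_antisymm (range_d2_le fun x y => ?_) (Submodule.span_le.2 ?_)
    · rw [hb]
      exact Submodule.smul_mem _ _ (Submodule.mem_span_singleton_self _)
    · rw [Set.singleton_subset_iff]
      exact ⟨wedge F (b 0) (b 1), by rw [d2_wedge, h01]⟩
  have h₃ : LinearMap.range (d3 F L) = Submodule.span F {wedge F (b 2) (b 3)} := by
    refine le_antisymm (range_d3_le fun x y z => ?_) (Submodule.span_le.2 ?_)
    · refine Submodule.mem_span_singleton.2
        ⟨minor (b.coord 0) (b.coord 1) x y * b.coord 3 z -
          minor (b.coord 0) (b.coord 1) x z * b.coord 3 y +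
          minor (b.coord 0) (b.coord 1) y z * b.coord 3 x, ?_⟩
      -- The terms `b 2 ∧ b 0` and `b 2 ∧ b 1` cancel: their coefficients are `3 × 3` determinants
      -- with a repeated row.
      simp only [hb, wedge_smul_left]
      rw [wedge_eq_sum b _ x, wedge_eq_sum b _ y, wedge_eq_sum b _ z]
      simp only [Fin.sum_univ_four, wedge_self, minor_apply]
      module
    · rw [Set.singleton_subset_iff]
      have := wedge_mem_range_d3 (F := F) (b 0) (b 1) (b 3)
      rwa [h01, h03, h13, wedge_zero_left, wedge_zero_left, sub_zero, add_zero] at this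
  have hne : wedge F (b 2) (b 3) ≠ 0 := fun h => by
    have := plucker_wedge (b.coord 2) (b.coord 3) (b 2) (b 3)
    rw [h] at this
    simp [minor_apply] at this
  rw [h₂, h₃, finrank_span_singleton (b.ne_zero 2), finrank_span_singleton hne,
    finrank_eq_card_basis b]
  rfl

/-- For `L_{4,3}` both differentials have rank two, with images spanned by `b 2, b 3` and by
`b 3 ∧ b 1, b 2 ∧ b 3`. -/
theorem nonempty_schurMultiplier_equiv_filiform
    (hb : ∀ l k : L, ⁅l, k⁆ = minor (b.coord 0) (b.coord 1) l k • b 2 +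
      minor (b.coord 0) (b.coord 2) l k • b 3) :
    Nonempty (SchurMultiplier F L ≃ₗ⁅F⁆ A F 2) := by
  have := Module.Finite.of_basis b
  apply nonempty_schurMultiplier_equiv
  have h01 : ⁅b 0, b 1⁆ = b 2 := by simp [hb, minor_apply]
  have h02 : ⁅b 0, b 2⁆ = b 3 := by simp [hb, minor_apply]
  have h12 : ⁅b 1, b 2⁆ = 0 := by simp [hb, minor_apply]
  have h03 : ⁅b 0, b 3⁆ = 0 := by simp [hb, minor_apply]
  have h13 : ⁅b 1, b 3⁆ = 0 := by simp [hb, minor_apply]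
  have h₂ : LinearMap.range (d2 F L) = Submodule.span F (Set.range ![b 2, b 3]) := by
    rw [Matrix.range_cons_cons_empty]
    refine le_antisymm (range_d2_le fun x y => ?_) (Submodule.span_le.2 ?_)
    · exact Submodule.mem_span_pair.2 ⟨_, _, (hb x y).symm⟩
    · rintro _ (rfl | rfl)
      · exact ⟨wedge F (b 0) (b 1), by rw [d2_wedge, h01]⟩
      · exact ⟨wedge F (b 0) (b 2), by rw [d2_wedge, h02]⟩
  have h₃ : LinearMap.range (d3 F L) =
      Submodule.span F (Set.range ![wedge F (b 3) (b 1), wedge F (b 2) (b 3)]) := by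
    rw [Matrix.range_cons_cons_empty]
    refine le_antisymm (range_d3_le fun x y z => ?_) (Submodule.span_le.2 ?_)
    · refine Submodule.mem_span_pair.2
        ⟨minor (b.coord 0) (b.coord 2) x y * b.coord 1 z -
          minor (b.coord 0) (b.coord 2) x z * b.coord 1 y +
          minor (b.coord 0) (b.coord 2) y z * b.coord 1 x,
          minor (b.coord 0) (b.coord 1) x y * b.coord 3 z -
          minor (b.coord 0) (b.coord 1) x z * b.coord 3 y +
          minor (b.coord 0) (b.coord 1) y z * b.coord 3 x, ?_⟩
      simp only [hb, wedge_smul_left, wedge_add_left]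
      rw [wedge_eq_sum b (b 2) x, wedge_eq_sum b (b 2) y, wedge_eq_sum b (b 2) z,
        wedge_eq_sum b (b 3) x, wedge_eq_sum b (b 3) y, wedge_eq_sum b (b 3) z]
      simp only [Fin.sum_univ_four, wedge_self, minor_apply, wedge_swap F L (b 2) (b 3)]
      module
    · rintro _ (rfl | rfl)
      · have := wedge_mem_range_d3 (F := F) (b 0) (b 1) (b 2)
        rw [h01, h02, h12, wedge_zero_left, wedge_self, zero_sub, add_zero] at this
        exact neg_mem_iff.1 this
      · have := wedge_mem_range_d3 (F := F) (b 0) (b 1) (b 3)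
        rwa [h01, h03, h13, wedge_zero_left, wedge_zero_left, sub_zero, add_zero] at this
  have hi₂ : LinearIndependent F ![b 2, b 3] := by
    rw [LinearIndependent.pair_iff]
    intro c d h
    have hc := congrArg (b.coord 2) h
    have hd := congrArg (b.coord 3) h
    simp at hc hd
    exact ⟨hc, hd⟩
  have hi₃ : LinearIndependent F ![wedge F (b 3) (b 1), wedge F (b 2) (b 3)] := by
    rw [LinearIndependent.pair_iff]
    intro c d h
    have hc := congrArg (plucker (b.coord 3) (b.coord 1)) h
    have hd := congrArg (plucker (b.coord 2) (b.coord 3)) h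
    simp [plucker_wedge, minor_apply] at hc hd
    exact ⟨hc, hd⟩
  rw [h₂, h₃, finrank_span_eq_card hi₂, finrank_span_eq_card hi₃, finrank_eq_card_basis b]
  rfl

end Schur

/-! ### The three Lie algebras in coordinates -/

section Bases

variable (F : Type*) [Field F]

/-- The standard basis of `A(n)`. -/
def A.basis (n : ℕ) : Basis (Fin n) F (A F n) := Pi.basisFun F (Fin n)

/-- The basis `x₁, x₂, x, y` of `H(1) ⊕ A(1)`, where `y` spans `A(1)`. -/
def L42.basis : Basis (Fin 4) F (L42 F) :=
  Basis.ofEquivFun (M := (Fin 3 → F) × (Fin 1 → F))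
    { toFun := fun x => ![x.1 0, x.1 1, x.1 2, x.2 0]
      invFun := fun v => (![v 0, v 1, v 2], ![v 3])
      map_add' := fun x y => by ext i; fin_cases i <;> rfl
      map_smul' := fun c x => by ext i; fin_cases i <;> rfl
      left_inv := fun x => by ext i <;> fin_cases i <;> rfl
      right_inv := fun v => by ext i; fin_cases i <;> rfl }

theorem L42.lie_eq (l k : L42 F) :
    ⁅l, k⁆ = minor ((L42.basis F).coord 0) ((L42.basis F).coord 1) l k • L42.basis F 2 := by
  refine (L42.basis F).ext_elem fun i => ?_
  rw [map_smul, Basis.repr_self]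
  fin_cases i
  · change (0 : F) = _; simp
  · change (0 : F) = _; simp
  · simp; rfl
  · change (0 : F) = _; simp

/-- The standard basis of `L_{4,3}`. -/
def L43.basis : Basis (Fin 4) F (L43 F) := Pi.basisFun F (Fin 4)

theorem L43.lie_eq (l k : L43 F) :
    ⁅l, k⁆ = minor ((L43.basis F).coord 0) ((L43.basis F).coord 1) l k • L43.basis F 2 +
      minor ((L43.basis F).coord 0) ((L43.basis F).coord 2) l k • L43.basis F 3 := by
  refine (L43.basis F).ext_elem fun i => ?_
  rw [map_add, map_smul, map_smul, Basis.repr_self, Basis.repr_self]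
  fin_cases i
  · change (0 : F) = _; simp
  · change (0 : F) = _; simp
  · simp; rfl
  · simp; rfl

end Bases

end NilpotentLie

end

theorem lemma2p6 (F : Type*) [Field F] :
    -- Schur multipliers
    (Nonempty (NilpotentLie.SchurMultiplier F (NilpotentLie.L41 F) ≃ₗ⁅F⁆ NilpotentLie.A F 6) ∧
      Nonempty (NilpotentLie.SchurMultiplier F (NilpotentLie.L42 F) ≃ₗ⁅F⁆ NilpotentLie.A F 4) ∧
      Nonempty (NilpotentLie.SchurMultiplier F (NilpotentLie.L43 F) ≃ₗ⁅F⁆ NilpotentLie.A F 2)) ∧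
    -- nonabelian exterior squares
    (Nonempty (NilpotentLie.ExteriorSquare F (NilpotentLie.L41 F) ≃ₗ⁅F⁆ NilpotentLie.A F 6) ∧
      Nonempty (NilpotentLie.ExteriorSquare F (NilpotentLie.L42 F) ≃ₗ⁅F⁆ NilpotentLie.A F 5) ∧
      Nonempty (NilpotentLie.ExteriorSquare F (NilpotentLie.L43 F) ≃ₗ⁅F⁆ NilpotentLie.A F 4)) ∧
    -- nonabelian tensor squares
    (Nonempty (NilpotentLie.TensorSquare F (NilpotentLie.L41 F) ≃ₗ⁅F⁆ NilpotentLie.A F 16) ∧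
      Nonempty (NilpotentLie.TensorSquare F (NilpotentLie.L42 F) ≃ₗ⁅F⁆ NilpotentLie.A F 11) ∧
      Nonempty (NilpotentLie.TensorSquare F (NilpotentLie.L43 F) ≃ₗ⁅F⁆ NilpotentLie.A F 7)) ∧
    -- diagonal ideals
    (Nonempty (NilpotentLie.diagonalIdeal F (NilpotentLie.L41 F) ≃ₗ⁅F⁆ NilpotentLie.A F 10) ∧
      Nonempty (NilpotentLie.diagonalIdeal F (NilpotentLie.L42 F) ≃ₗ⁅F⁆ NilpotentLie.A F 6) ∧
      Nonempty (NilpotentLie.diagonalIdeal F (NilpotentLie.L43 F) ≃ₗ⁅F⁆ NilpotentLie.A F 3)) := by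
  have h₁ := NilpotentLie.isTensorFrame_of_lie_eq_zero (NilpotentLie.A.basis F 4) fun _ _ => rfl
  have h₂ := NilpotentLie.isTensorFrame_heisenberg (NilpotentLie.L42.basis F)
    (NilpotentLie.L42.lie_eq F)
  have h₃ := NilpotentLie.isTensorFrame_filiform (NilpotentLie.L43.basis F)
    (NilpotentLie.L43.lie_eq F)
  have := Module.Finite.of_basis (NilpotentLie.A.basis F 4)
  exact ⟨⟨NilpotentLie.nonempty_schurMultiplier_equiv_of_lie_eq_zero (fun _ _ => rfl)
        (by rw [Module.finrank_eq_card_basis (NilpotentLie.A.basis F 4)]; rfl),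
      NilpotentLie.nonempty_schurMultiplier_equiv_heisenberg (NilpotentLie.L42.basis F)
        (NilpotentLie.L42.lie_eq F),
      NilpotentLie.nonempty_schurMultiplier_equiv_filiform (NilpotentLie.L43.basis F)
        (NilpotentLie.L43.lie_eq F)⟩,
    ⟨h₁.nonempty_exteriorSquare_equiv rfl, h₂.nonempty_exteriorSquare_equiv rfl,
      h₃.nonempty_exteriorSquare_equiv rfl⟩,
    ⟨h₁.nonempty_tensorSquare_equiv rfl, h₂.nonempty_tensorSquare_equiv rfl,
      h₃.nonempty_tensorSquare_equiv rfl⟩,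
    ⟨h₁.nonempty_diagonalIdeal_equiv rfl, h₂.nonempty_diagonalIdeal_equiv rfl,
      h₃.nonempty_diagonalIdeal_equiv rfl⟩⟩
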